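/- Let $n\ge 4$ be an even integer, $a\in\mathbb{R}$, $D>0$, $\sigma>0$, and let $U_0(x)=-\frac a2x^2+\frac1n x^n$. For $m\in\mathbb{R}$ put $$p_s(x,m)=\frac1{Z(m)}\exp\Big[-\frac2{\sigma^2}\Big(U_0(x)+\tfrac12Dx^2-Dmx\Big)\Big],\qquad Z(m)=\int_{-\infty}^{\infty}\exp\Big[-\frac2{\sigma^2}\Big(U_0(x)+\tfrac12Dx^2-Dmx\Big)\Big]dx,$$ and let $F(m)=\int_{-\infty}^{\infty}x\,p_s(x,m)\,dx$ be the self-consistency map. Then all these integrals converge absolutely, $Z(m)>0$ for all $m$, $F:\mathbb{R}\to\mathbb{R}$ is infinitely differentiable, and: 1. $F^{(2k)}(0)=0$ for all $k=0,1,2,\dots$; 2. $F(m)=-F(-m)$ for all $m$; 3. $F''(m)<0$ for $m>0$, $F''(0)=0$, and $F''(m)>0$ for $m<0$; 4. $F'(m)\to0$ as $m\to\infty$. Call a fixed point $m^*$ of $F$ stable if it is asymptotically stable under iteration of $F$: for every $\varepsilon>0$ there is $\delta>0$ such that $|m-m^*|<\delta$ implies $|F^{k}(m)-m^*|<\varepsilon$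 for all $k\ge0$ (Lyapunov stability; here $F^k$ is the $k$-th iterate), and $F^{k}(m)\to m^*$ as $k\to\infty$ for all $m$ sufficiently close to $m^*$. Call it unstable if it is not Lyapunov stable. * If $F'(0)\le1$, then $m=0$ is the only fixed point of $F$, and it is stable. * If $F'(0)>1$, then $m=0$ is an unstable fixed point, and there is exactly one positive fixed point $m_+$ and exactly one negative fixed point, namely $-m_+$. Both $m_+$ and $-m_+$ are stable, and they break the reflection symmetry: $x\mapsto p_s(x,m_+)$ and $x\mapsto p_s(x,-m_+)$ are not even functions. -/

import Mathlib

open Filter Topology MeasureTheory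
open scoped ContDiff

noncomputable section

/-- The single-particle potential `U₀(x) = -(a/2) x² + (1/n) xⁿ`. -/
def doubleWell (n : ℕ) (a x : ℝ) : ℝ :=
  -(a / 2) * x ^ 2 + (1 / (n : ℝ)) * x ^ n

/-- The unnormalized stationary weight
`exp[-(2/σ²) (U₀(x) + D x²/2 - D m x)]` at mean field `m`. -/
def stationaryWeight (U₀ : ℝ → ℝ) (D σ m x : ℝ) : ℝ :=
  Real.exp (-(2 / σ ^ 2) * (U₀ x + (1 / 2) * D * x ^ 2 - D * m * x))

/-- The normalization `Z`. -/
def stationaryZ (U₀ : ℝ → ℝ) (D σ m : ℝ) : ℝ :=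
  ∫ x, stationaryWeight U₀ D σ m x

/-- The density `p_s(x, m)` at mean field `m`. -/
def stationaryDensity (U₀ : ℝ → ℝ) (D σ m x : ℝ) : ℝ :=
  (1 / stationaryZ U₀ D σ m) * stationaryWeight U₀ D σ m x

/-- The self-consistency map `F(m) = ∫ x p_s(x, m) dx`. -/
def selfConsistencyMap (U₀ : ℝ → ℝ) (D σ m : ℝ) : ℝ :=
  ∫ x, x * stationaryDensity U₀ D σ m x

/-- Lyapunov stability of the point `p` under iteration of `F`. -/
def IsLyapunovStable (F : ℝ → ℝ) (p : ℝ) : Prop :=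
  ∀ ε > 0, ∃ δ > 0, ∀ x, |x - p| < δ → ∀ k : ℕ, |F^[k] x - p| < ε

/-- `p` is an (asymptotically) stable fixed point of the map `F`: it is a fixed point, it is
Lyapunov stable under iteration of `F`, and it attracts all nearby points. -/
structure IsStableFixedPt (F : ℝ → ℝ) (p : ℝ) : Prop where
  isFixedPt : Function.IsFixedPt F p
  lyapunov : IsLyapunovStable F p
  attracting : ∃ δ > 0, ∀ x, |x - p| < δ → Tendsto (fun k : ℕ => F^[k] x) atTop (𝓝 p)

/-- `p` is an unstable fixed point of the map `F`: a fixed point that is not Lyapunov stable. -/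
structure IsUnstableFixedPt (F : ℝ → ℝ) (p : ℝ) : Prop where
  isFixedPt : Function.IsFixedPt F p
  not_lyapunov : ¬ IsLyapunovStable F p

end

/-! Completing the exponent gives `F m = M (β m)`, where `M t` is the mean of the normalized weight
`exp (t x - V x)`, with `V x = b x² + c xⁿ` and `β = 2D/σ²`. Derivatives of `M` are cumulants: `M'`
is the variance, hence positive, and `M''` is the third central moment.

The heart is that this third moment is negative for `t > 0` (`integral_sub_tiltedMean_cube_neg`).
Reflect the weight about its mean `M > 0`: the log-ratio of its values at `M + y` and `M - y` is
strictly concave on `y ≥ 0`, because `V''` is even and increasing in `|x|` up to a constant. So the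
antisymmetrized weight is positive up to some `y₀` and negative beyond it; as its first moment
vanishes, its third is negative.

Next, `F' → 0` because a variance bounded below would make the partition function grow faster than
the superquadratic potential allows (`exists_deriv_tiltedMean_lt`). What remains is the dynamics of
an odd increasing map, strictly concave on the half-line: `F m / m` decreases there, which decides
existence, uniqueness and stability of fixed points. -/

/-! ### Sign changes and odd moments -/

/-- Chords from the origin have decreasing slope. This serves both the single sign change of the
log-ratio and the uniqueness of the positive fixed point. -/
theorem StrictConcaveOn.mul_lt_mul_of_map_zero {f : ℝ → ℝ} (hf : StrictConcaveOn ℝ (Set.Ici 0) f)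
    (h0 : f 0 = 0) {x y : ℝ} (hx : 0 < x) (hxy : x < y) : x * f y < y * f x := by
  have hy : 0 < y := hx.trans hxy
  have h := hf.2 (Set.mem_Ici.2 le_rfl) (Set.mem_Ici.2 hy.le) hy.ne
    (sub_pos.2 ((div_lt_one hy).2 hxy)) (div_pos hx hy) (sub_add_cancel 1 (x / y))
  simp only [smul_eq_mul, h0, mul_zero, zero_add, div_mul_cancel₀ x hy.ne'] at h
  rw [div_mul_eq_mul_div, div_lt_iff₀ hy] at h
  linarith

/-- Both `y₀² - y²` and `g` change sign from positive to negative at `y₀`, so `y (y₀² - y²) g y` is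
nonnegative for `y > 0`, and by parity everywhere. The first-moment term of its integral vanishes.
-/
theorem integral_cube_mul_neg_of_crossing {g : ℝ → ℝ} (hg : Continuous g)
    (hodd : ∀ y, g (-y) = -g y) (hi1 : Integrable fun y => y * g y)
    (hi3 : Integrable fun y => y ^ 3 * g y) (h1 : ∫ y, y * g y = 0)
    {y₀ : ℝ} (hy₀ : 0 < y₀) (hpos : ∀ y, 0 < y → y < y₀ → 0 < g y)
    (hneg : ∀ y, y₀ < y → g y < 0) : ∫ y, y ^ 3 * g y < 0 := by
  have hnn : ∀ y, 0 < y → 0 ≤ y₀ ^ 2 * (y * g y) - y ^ 3 * g y := by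
    intro y hy
    have e : y₀ ^ 2 * (y * g y) - y ^ 3 * g y = y * (y₀ + y) * ((y₀ - y) * g y) := by ring
    rw [e]
    refine mul_nonneg (by positivity) ?_
    rcases lt_trichotomy y y₀ with h | h | h
    · exact mul_nonneg (by linarith) (hpos y hy h).le
    · simp [h]
    · exact mul_nonneg_of_nonpos_of_nonpos (by linarith) (hneg y h).le
  have key : 0 < ∫ y, (y₀ ^ 2 * (y * g y) - y ^ 3 * g y) := by
    refine integral_pos_of_integrable_nonneg_nonzero (x := y₀ / 2) (by fun_prop)
      ((hi1.const_mul _).sub hi3) ?_ ?_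
    · intro y
      rcases lt_trichotomy y 0 with h | h | h
      · have := hnn (-y) (by linarith)
        rw [hodd] at this
        simp only [Pi.zero_apply]
        linarith
      · simp [h]
      · exact hnn y h
    · have h := hpos (y₀ / 2) (by linarith) (by linarith)
      have e : y₀ ^ 2 * (y₀ / 2 * g (y₀ / 2)) - (y₀ / 2) ^ 3 * g (y₀ / 2)
        = 3 / 8 * y₀ ^ 3 * g (y₀ / 2) := by ring
      rw [e]
      positivity
  rw [integral_sub (hi1.const_mul _) hi3, integral_const_mul, h1] at key
  linarith

theorem integral_mul_pos_of_odd_of_pos {g : ℝ → ℝ} (hg : Continuous g)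
    (hodd : ∀ y, g (-y) = -g y) (hi1 : Integrable fun y => y * g y)
    (hpos : ∀ y, 0 < y → 0 < g y) : 0 < ∫ y, y * g y := by
  refine integral_pos_of_integrable_nonneg_nonzero (x := 1) (by fun_prop) hi1 ?_ ?_
  · intro y
    rcases lt_trichotomy y 0 with h | h | h
    · have := mul_pos (by linarith : 0 < -y) (hpos (-y) (by linarith))
      rw [hodd] at this
      simp only [Pi.zero_apply]
      linarith
    · simp [h]
    · exact (mul_pos h (hpos y h)).le
  · have := hpos 1 one_pos
    simpa using this.ne'

/-- An odd function on the line whose sign on the positive half-line is that of a strictly concave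
function vanishing at the origin, and whose first moment vanishes, has a negative third moment. -/
theorem integral_cube_mul_neg_of_strictConcaveOn {g r : ℝ → ℝ} (hg : Continuous g)
    (hodd : ∀ y, g (-y) = -g y) (hi1 : Integrable fun y => y * g y)
    (hi3 : Integrable fun y => y ^ 3 * g y) (h1 : ∫ y, y * g y = 0)
    (hr : Continuous r) (hr0 : r 0 = 0) (hrc : StrictConcaveOn ℝ (Set.Ici 0) r)
    (hgpos : ∀ y, 0 < y → (0 < r y → 0 < g y)) (hgneg : ∀ y, 0 < y → (r y < 0 → g y < 0)) :
    ∫ y, y ^ 3 * g y < 0 := by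
  -- Without a zero, `r`, and with it `g`, would have constant sign on the half-line, against the
  -- vanishing first moment.
  obtain ⟨y₀, hy₀, hz⟩ : ∃ y₀, 0 < y₀ ∧ r y₀ = 0 := by
    by_contra! hne
    have hsign : (∀ y, 0 < y → 0 < r y) ∨ (∀ y, 0 < y → r y < 0) := by
      by_contra! h
      obtain ⟨⟨x, hx, hx'⟩, y, hy, hy'⟩ := h
      obtain ⟨z, hz, hz'⟩ := (isPreconnected_Ioi (a := (0 : ℝ))).intermediate_value
        (Set.mem_Ioi.2 hx) (Set.mem_Ioi.2 hy) hr.continuousOn ⟨hx', hy'⟩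
      exact hne z hz hz'
    rcases hsign with h | h
    · exact (integral_mul_pos_of_odd_of_pos hg hodd hi1 fun y hy => hgpos y hy (h y hy)).ne' h1
    · have := integral_mul_pos_of_odd_of_pos (g := fun y => -g y) hg.neg
        (fun y => by rw [hodd]) (by simpa using hi1.neg)
        (fun y hy => neg_pos.2 (hgneg y hy (h y hy)))
      simp [integral_neg, h1] at this
  refine integral_cube_mul_neg_of_crossing hg hodd hi1 hi3 h1 hy₀ (fun y hy h => ?_)
    (fun y h => ?_)
  · have := hrc.mul_lt_mul_of_map_zero hr0 hy h
    rw [hz, mul_zero] at this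
    exact hgpos y hy (pos_of_mul_pos_right this hy₀.le)
  · have := hrc.mul_lt_mul_of_map_zero hr0 hy₀ h
    rw [hz, mul_zero] at this
    exact hgneg y (hy₀.trans h) (by nlinarith)

/-- Odd moments see only the antisymmetric part of `p`, so moment questions reduce to odd functions.
-/
theorem integral_mul_sub_comp_neg_of_odd {φ p : ℝ → ℝ} (hφ : ∀ y, φ (-y) = -φ y)
    (hi : Integrable fun y => φ y * p y) :
    Integrable (fun y => φ y * (p y - p (-y))) ∧
      ∫ y, φ y * (p y - p (-y)) = 2 * ∫ y, φ y * p y := by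
  have e : (fun y => φ y * (p y - p (-y))) = fun y => φ y * p y + φ (-y) * p (-y) := by
    funext y; rw [hφ]; ring
  have hi' : Integrable fun y => φ (-y) * p (-y) := hi.comp_neg
  rw [e]
  refine ⟨hi.add hi', ?_⟩
  rw [integral_add hi hi', integral_neg_eq_self (fun y => φ y * p y)]
  ring

/-! ### Tilted weights and their moments -/

/-- The even potential `b x² + c xⁿ`. -/
def evenPotential (n : ℕ) (b c x : ℝ) : ℝ := b * x ^ 2 + c * x ^ n

/-- The weight `exp (t x - V x)` of the even potential in an external field `t`. -/
noncomputable def tiltedWeight (n : ℕ) (b c t x : ℝ) : ℝ :=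
  Real.exp (t * x - evenPotential n b c x)

/-- The moments of the tilted weight. -/
noncomputable def tiltedMoment (n : ℕ) (b c : ℝ) (k : ℕ) (t : ℝ) : ℝ :=
  ∫ x, x ^ k * tiltedWeight n b c t x

/-- The mean of the normalized tilted weight. -/
noncomputable def tiltedMean (n : ℕ) (b c t : ℝ) : ℝ :=
  tiltedMoment n b c 1 t / tiltedMoment n b c 0 t

section Potential

variable {n : ℕ} {b c : ℝ}

theorem exists_forall_mul_sq_sub_le_evenPotential (hne : Even n) (hn : 4 ≤ n) (hc : 0 < c)
    (K : ℝ) : ∃ C, ∀ x, K * x ^ 2 - C ≤ evenPotential n b c x := by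
  -- The summand `c` pays for replacing `xⁿ` by `x⁴ - 1`; the other comes from completing the square
  -- in `x²`.
  refine ⟨c + (K - b) ^ 2 / (4 * c), fun x => ?_⟩
  have hx : x ^ 4 - 1 ≤ x ^ n := by
    rw [← hne.pow_abs, ← (show Even 4 by decide).pow_abs]
    rcases le_total |x| 1 with h | h
    · have h1 : |x| ^ 4 ≤ 1 := pow_le_one₀ (abs_nonneg x) h
      have h2 : 0 ≤ |x| ^ n := by positivity
      linarith
    · linarith [pow_le_pow_right₀ h hn]
  have hsq : 0 ≤ c * (x ^ 2 - (K - b) / (2 * c)) ^ 2 := by positivity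
  have e : c * (x ^ 2 - (K - b) / (2 * c)) ^ 2
      = c * x ^ 4 - (K - b) * x ^ 2 + (K - b) ^ 2 / (4 * c) := by
    field_simp
    ring
  have := mul_le_mul_of_nonneg_left hx hc.le
  unfold evenPotential
  linarith

theorem continuous_tiltedWeight (t : ℝ) : Continuous (tiltedWeight n b c t) := by
  unfold tiltedWeight evenPotential
  fun_prop

theorem tiltedWeight_pos (t x : ℝ) : 0 < tiltedWeight n b c t x := Real.exp_pos _

theorem tiltedWeight_neg (hne : Even n) (t x : ℝ) :
    tiltedWeight n b c (-t) x = tiltedWeight n b c t (-x) := by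
  unfold tiltedWeight evenPotential
  rw [hne.neg_pow]
  ring_nf

/-- The field costs only `exp (κ t²)` with `κ` as small as desired, and `C` does not depend on `t`.
In the quadratic bound, `1 / (4κ)` absorbs `t x` and the extra `1` leaves a Gaussian. -/
theorem exists_tiltedWeight_le (hne : Even n) (hn : 4 ≤ n) (hc : 0 < c) {κ : ℝ} (hκ : 0 < κ) :
    ∃ C, ∀ t x, tiltedWeight n b c t x ≤ C * Real.exp (κ * t ^ 2) * Real.exp (-1 * x ^ 2) := by
  obtain ⟨C, hC⟩ := exists_forall_mul_sq_sub_le_evenPotential (b := b) hne hn hc (1 / (4 * κ) + 1)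
  refine ⟨Real.exp C, fun t x => ?_⟩
  rw [← Real.exp_add, ← Real.exp_add]
  refine Real.exp_le_exp.2 ?_
  have h := hC x
  have hsq : 0 ≤ κ * (t - x / (2 * κ)) ^ 2 := by positivity
  have e : κ * (t - x / (2 * κ)) ^ 2 = κ * t ^ 2 - t * x + 1 / (4 * κ) * x ^ 2 := by
    field_simp
    ring
  linarith

theorem integrable_tiltedWeight (hne : Even n) (hn : 4 ≤ n) (hc : 0 < c) (t : ℝ) :
    Integrable (tiltedWeight n b c t) := by
  obtain ⟨C, hC⟩ := exists_tiltedWeight_le (b := b) hne hn hc one_pos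
  refine ((integrable_exp_neg_mul_sq one_pos).const_mul (C * Real.exp (1 * t ^ 2))).mono'
    (continuous_tiltedWeight t).aestronglyMeasurable (.of_forall fun x => ?_)
  rw [Real.norm_of_nonneg (tiltedWeight_pos t x).le]
  exact hC t x

/-- The measure with density `exp (-V)`. -/
noncomputable def gibbsMeasure (n : ℕ) (b c : ℝ) : Measure ℝ :=
  volume.withDensity fun x => ((Real.exp (-evenPotential n b c x)).toNNReal : ENNReal)

theorem measurable_gibbsDensity :
    Measurable fun x => (Real.exp (-evenPotential n b c x)).toNNReal := by
  unfold evenPotential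
  fun_prop

theorem gibbsDensity_smul (t x : ℝ) (k : ℕ) :
    (Real.exp (-evenPotential n b c x)).toNNReal • (x ^ k * Real.exp (t * x))
      = x ^ k * tiltedWeight n b c t x := by
  rw [NNReal.smul_def, Real.coe_toNNReal _ (Real.exp_pos _).le, tiltedWeight, sub_eq_add_neg,
    Real.exp_add, smul_eq_mul]
  ring

theorem integrable_gibbsMeasure_iff (t : ℝ) (k : ℕ) :
    Integrable (fun x => x ^ k * Real.exp (t * x)) (gibbsMeasure n b c) ↔
      Integrable fun x => x ^ k * tiltedWeight n b c t x := by
  rw [gibbsMeasure, integrable_withDensity_iff_integrable_smul measurable_gibbsDensity]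
  simp only [gibbsDensity_smul]

theorem integral_gibbsMeasure (t : ℝ) (k : ℕ) :
    ∫ x, x ^ k * Real.exp (t * x) ∂gibbsMeasure n b c = tiltedMoment n b c k t := by
  rw [gibbsMeasure, integral_withDensity_eq_integral_smul measurable_gibbsDensity]
  simp only [gibbsDensity_smul, tiltedMoment]

/-- Exponential moments of every order are finite, so the calculus of moment generating functions
gives integrability and differentiation under the integral at every `t`. -/
theorem mem_interior_integrableExpSet (hne : Even n) (hn : 4 ≤ n) (hc : 0 < c) (t : ℝ) :
    t ∈ interior (ProbabilityTheory.integrableExpSet (fun x : ℝ => x) (gibbsMeasure n b c)) := by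
  have : ProbabilityTheory.integrableExpSet (fun x : ℝ => x) (gibbsMeasure n b c) = Set.univ := by
    refine Set.eq_univ_of_forall fun s => ?_
    have := (integrable_gibbsMeasure_iff (n := n) (b := b) (c := c) s 0).2
      (by simpa using integrable_tiltedWeight hne hn hc s)
    simpa [ProbabilityTheory.integrableExpSet] using this
  simp [this]

theorem integrable_pow_mul_tiltedWeight (hne : Even n) (hn : 4 ≤ n) (hc : 0 < c) (k : ℕ)
    (t : ℝ) : Integrable fun x => x ^ k * tiltedWeight n b c t x :=
  (integrable_gibbsMeasure_iff t k).1
    (ProbabilityTheory.integrable_pow_mul_exp_of_mem_interior_integrableExpSet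
      (mem_interior_integrableExpSet hne hn hc t) k)

theorem hasDerivAt_tiltedMoment (hne : Even n) (hn : 4 ≤ n) (hc : 0 < c) (k : ℕ) (t : ℝ) :
    HasDerivAt (tiltedMoment n b c k) (tiltedMoment n b c (k + 1) t) t := by
  have := ProbabilityTheory.hasDerivAt_integral_pow_mul_exp_real
    (mem_interior_integrableExpSet (b := b) hne hn hc t) k
  simpa only [integral_gibbsMeasure] using this

theorem contDiff_tiltedMoment (hne : Even n) (hn : 4 ≤ n) (hc : 0 < c) (k : ℕ) :
    ContDiff ℝ ∞ (tiltedMoment n b c k) := by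
  rw [contDiff_infty]
  intro m
  induction m generalizing k with
  | zero =>
    exact contDiff_zero.2 (continuous_iff_continuousAt.2 fun t =>
      (hasDerivAt_tiltedMoment hne hn hc k t).continuousAt)
  | succ m ih =>
    have hd : deriv (tiltedMoment n b c k) = tiltedMoment n b c (k + 1) :=
      funext fun t => (hasDerivAt_tiltedMoment hne hn hc k t).deriv
    push_cast
    rw [contDiff_succ_iff_deriv, hd]
    exact ⟨fun t => (hasDerivAt_tiltedMoment hne hn hc k t).differentiableAt, by simp, ih (k + 1)⟩

theorem tiltedMoment_zero_pos (hne : Even n) (hn : 4 ≤ n) (hc : 0 < c) (t : ℝ) :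
    0 < tiltedMoment n b c 0 t := by
  simp only [tiltedMoment, pow_zero, one_mul]
  exact integral_pos_of_integrable_nonneg_nonzero (x := 0) (continuous_tiltedWeight t)
    (integrable_tiltedWeight hne hn hc t) (fun x => (tiltedWeight_pos t x).le)
    (tiltedWeight_pos t 0).ne'

theorem contDiff_tiltedMean (hne : Even n) (hn : 4 ≤ n) (hc : 0 < c) :
    ContDiff ℝ ∞ (tiltedMean n b c) :=
  (contDiff_tiltedMoment hne hn hc 1).div (contDiff_tiltedMoment hne hn hc 0)
    fun t => (tiltedMoment_zero_pos hne hn hc t).ne'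

theorem tiltedMoment_neg (hne : Even n) (k : ℕ) (t : ℝ) :
    tiltedMoment n b c k (-t) = (-1) ^ k * tiltedMoment n b c k t := by
  simp only [tiltedMoment, tiltedWeight_neg hne]
  rw [← integral_neg_eq_self (fun x => x ^ k * tiltedWeight n b c t (-x)), ← integral_const_mul]
  congr 1
  funext x
  rw [neg_neg, neg_pow]
  ring

theorem tiltedMean_neg (hne : Even n) (t : ℝ) : tiltedMean n b c (-t) = -tiltedMean n b c t := by
  simp [tiltedMean, tiltedMoment_neg hne, neg_div]

theorem tiltedMean_pos (hne : Even n) (hn : 4 ≤ n) (hc : 0 < c) {t : ℝ} (ht : 0 < t) :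
    0 < tiltedMean n b c t := by
  refine div_pos ?_ (tiltedMoment_zero_pos hne hn hc t)
  obtain ⟨h1, h2⟩ := integral_mul_sub_comp_neg_of_odd (φ := fun y => y)
    (p := tiltedWeight n b c t) (fun _ => rfl)
    (by simpa using integrable_pow_mul_tiltedWeight hne hn hc 1 t)
  have hw := continuous_tiltedWeight (n := n) (b := b) (c := c) t
  have := integral_mul_pos_of_odd_of_pos
    (g := fun y => tiltedWeight n b c t y - tiltedWeight n b c t (-y)) (by fun_prop)
    (fun y => by rw [neg_neg]; ring) h1 (fun y hy => by
      rw [sub_pos, tiltedWeight, tiltedWeight]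
      refine Real.exp_lt_exp.2 ?_
      have := mul_pos ht hy
      unfold evenPotential
      rw [hne.neg_pow, neg_sq]
      linarith)
  rw [h2] at this
  simp only [tiltedMoment, pow_one]
  linarith

/-! ### Signs of the second and third cumulants -/

/-- In the second derivative the quadratic parts cancel, leaving `-c n (n-1) ((M+y)^(n-2) -
(M-y)^(n-2))`. This is negative since `|M - y| < M + y` and `n - 2` is even and positive. -/
theorem strictConcaveOn_evenPotential_reflection (hne : Even n) (hn : 4 ≤ n) (hc : 0 < c)
    (t : ℝ) {M : ℝ} (hM : 0 < M) :
    StrictConcaveOn ℝ (Set.Ici 0) fun y =>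
      (t * (M + y) - evenPotential n b c (M + y)) -
        (t * (M + -y) - evenPotential n b c (M + -y)) := by
  have h1 : ∀ y : ℝ, HasDerivAt (fun y =>
      (t * (M + y) - evenPotential n b c (M + y)) -
        (t * (M + -y) - evenPotential n b c (M + -y)))
      (2 * t - 4 * b * M - c * n * ((M + y) ^ (n - 1) + (M + -y) ^ (n - 1))) y := by
    intro y
    have hp : HasDerivAt (fun y : ℝ => M + y) 1 y := (hasDerivAt_id y).const_add M
    have hm : HasDerivAt (fun y : ℝ => M + -y) (-1) y := (hasDerivAt_id y).neg.const_add M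
    unfold evenPotential
    convert! ((hp.const_mul t).sub (((hp.pow 2).const_mul b).add ((hp.pow n).const_mul c))).sub
      ((hm.const_mul t).sub (((hm.pow 2).const_mul b).add ((hm.pow n).const_mul c))) using 1
    push_cast
    ring
  have h2 : ∀ y : ℝ, HasDerivAt (fun y =>
      2 * t - 4 * b * M - c * n * ((M + y) ^ (n - 1) + (M + -y) ^ (n - 1)))
      (-(c * n * ((n - 1 : ℕ) * ((M + y) ^ (n - 2) - (M + -y) ^ (n - 2))))) y := by
    intro y
    have hp : HasDerivAt (fun y : ℝ => M + y) 1 y := (hasDerivAt_id y).const_add M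
    have hm : HasDerivAt (fun y : ℝ => M + -y) (-1) y := (hasDerivAt_id y).neg.const_add M
    convert! (((hp.pow (n - 1)).add (hm.pow (n - 1))).const_mul (c * n)).const_sub
      (2 * t - 4 * b * M) using 1
    rw [show n - 1 - 1 = n - 2 by omega]
    ring
  refine strictConcaveOn_of_deriv2_neg (convex_Ici 0)
    (fun y _ => (h1 y).continuousAt.continuousWithinAt) fun y hy => ?_
  rw [interior_Ici, Set.mem_Ioi] at hy
  rw [Function.iterate_succ, Function.iterate_one, Function.comp_apply,
    funext fun y => (h1 y).deriv, (h2 y).deriv]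
  have hlt : (M + -y) ^ (n - 2) < (M + y) ^ (n - 2) := by
    have he : Even (n - 2) := (Nat.even_sub (by omega)).2 (by simp [hne])
    rw [← he.pow_abs]
    exact pow_lt_pow_left₀ (abs_lt.2 ⟨by linarith, by linarith⟩) (abs_nonneg _) (by omega)
  have hn0 : (0 : ℝ) < n := by exact_mod_cast (by omega : 0 < n)
  have hn1 : (0 : ℝ) < (n - 1 : ℕ) := by exact_mod_cast (by omega : 0 < n - 1)
  have := sub_pos.2 hlt
  rw [neg_lt_zero]
  positivity

theorem integral_sub_tiltedMean_cube_neg (hne : Even n) (hn : 4 ≤ n) (hc : 0 < c) {t : ℝ}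
    (ht : 0 < t) : ∫ x, (x - tiltedMean n b c t) ^ 3 * tiltedWeight n b c t x < 0 := by
  set M := tiltedMean n b c t with hM
  have hMpos : 0 < M := tiltedMean_pos hne hn hc ht
  have hI := fun k => integrable_pow_mul_tiltedWeight (b := b) hne hn hc k t
  have hI0 := hI 0
  have hI1 := hI 1
  have hI2 := hI 2
  have hI3 := hI 3
  simp only [pow_zero, one_mul, pow_one] at hI0 hI1
  have hi1 : Integrable fun x => (x - M) * tiltedWeight n b c t x := by
    simpa only [sub_mul] using hI1.sub' (hI0.const_mul M)
  have hi3 : Integrable fun x => (x - M) ^ 3 * tiltedWeight n b c t x := by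
    refine (((hI3.sub (hI2.const_mul (3 * M))).add (hI1.const_mul (3 * M ^ 2))).sub
      (hI0.const_mul (M ^ 3))).congr (.of_forall fun x => ?_)
    simp only [Pi.add_apply, Pi.sub_apply]
    ring
  have hm1 : ∫ x, (x - M) * tiltedWeight n b c t x = 0 := by
    simp only [sub_mul]
    rw [integral_sub hI1 (hI0.const_mul M), integral_const_mul]
    have e : tiltedMoment n b c 1 t = M * tiltedMoment n b c 0 t :=
      (div_mul_cancel₀ _ (tiltedMoment_zero_pos hne hn hc t).ne').symm
    simp only [tiltedMoment, pow_zero, one_mul, pow_one] at e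
    rw [e, sub_self]
  have hs1 := hi1.comp_add_left M
  have hs3 := hi3.comp_add_left M
  -- Centre at the mean, so that the reflection becomes `y ↦ -y`.
  rw [← integral_add_left_eq_self _ M] at hm1 ⊢
  simp only [add_sub_cancel_left] at hs1 hs3 hm1 ⊢
  obtain ⟨ha1, hb1⟩ := integral_mul_sub_comp_neg_of_odd (φ := fun y => y)
    (p := fun y => tiltedWeight n b c t (M + y)) (fun _ => rfl) hs1
  obtain ⟨ha3, hb3⟩ := integral_mul_sub_comp_neg_of_odd (φ := fun y => y ^ 3)
    (p := fun y => tiltedWeight n b c t (M + y)) (fun y => by ring) hs3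
  have hw := continuous_tiltedWeight (n := n) (b := b) (c := c) t
  have hconc := strictConcaveOn_evenPotential_reflection (b := b) hne hn hc t hMpos
  have := integral_cube_mul_neg_of_strictConcaveOn
    (g := fun y => tiltedWeight n b c t (M + y) - tiltedWeight n b c t (M + -y)) (by fun_prop)
    (fun y => by rw [neg_neg]; ring) ha1 ha3 (by rw [hb1, hm1, mul_zero])
    (by unfold evenPotential; fun_prop) (by simp) hconc
    (fun y _ h => sub_pos.2 (Real.exp_lt_exp.2 (sub_pos.1 h)))
    (fun y _ h => sub_neg.2 (Real.exp_lt_exp.2 (sub_neg.1 h)))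
  rw [hb3] at this
  linarith

theorem hasDerivAt_tiltedMean (hne : Even n) (hn : 4 ≤ n) (hc : 0 < c) (t : ℝ) :
    HasDerivAt (tiltedMean n b c)
      (tiltedMoment n b c 2 t / tiltedMoment n b c 0 t - tiltedMean n b c t ^ 2) t := by
  have h0 := (tiltedMoment_zero_pos (b := b) hne hn hc t).ne'
  convert! (hasDerivAt_tiltedMoment (b := b) hne hn hc 1 t).div
    (hasDerivAt_tiltedMoment hne hn hc 0 t) h0 using 1
  unfold tiltedMean
  field_simp

theorem deriv_tiltedMean (hne : Even n) (hn : 4 ≤ n) (hc : 0 < c) :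
    deriv (tiltedMean n b c) = fun t =>
      tiltedMoment n b c 2 t / tiltedMoment n b c 0 t - tiltedMean n b c t ^ 2 :=
  funext fun t => (hasDerivAt_tiltedMean hne hn hc t).deriv

theorem deriv_tiltedMean_pos (hne : Even n) (hn : 4 ≤ n) (hc : 0 < c) (t : ℝ) :
    0 < deriv (tiltedMean n b c) t := by
  have h0 := tiltedMoment_zero_pos (b := b) hne hn hc t
  have hI := fun k => integrable_pow_mul_tiltedWeight (b := b) hne hn hc k t
  set M := tiltedMean n b c t with hM
  have hw := continuous_tiltedWeight (n := n) (b := b) (c := c) t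
  have e : (fun x => (x - M) ^ 2 * tiltedWeight n b c t x) = fun x =>
      (x ^ 2 * tiltedWeight n b c t x - 2 * M * (x ^ 1 * tiltedWeight n b c t x))
        + M ^ 2 * (x ^ 0 * tiltedWeight n b c t x) := by
    funext x; ring
  have hi := ((hI 2).sub' ((hI 1).const_mul (2 * M))).add ((hI 0).const_mul (M ^ 2))
  -- Up to normalization this is the variance; `M + 1` is just a point off the mean.
  have hpos : 0 < ∫ x, (x - M) ^ 2 * tiltedWeight n b c t x :=
    integral_pos_of_integrable_nonneg_nonzero (x := M + 1) (by fun_prop)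
      (by rw [e]; exact hi) (fun x => mul_nonneg (sq_nonneg _) (tiltedWeight_pos t x).le)
      (by simpa using (tiltedWeight_pos t (M + 1)).ne')
  rw [e, integral_add ((hI 2).sub' ((hI 1).const_mul (2 * M))) ((hI 0).const_mul (M ^ 2)),
    integral_sub (hI 2) ((hI 1).const_mul (2 * M)), integral_const_mul, integral_const_mul] at hpos
  change 0 < tiltedMoment n b c 2 t - 2 * M * tiltedMoment n b c 1 t
    + M ^ 2 * tiltedMoment n b c 0 t at hpos
  have e1 : tiltedMoment n b c 1 t = M * tiltedMoment n b c 0 t := (div_mul_cancel₀ _ h0.ne').symm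
  rw [e1] at hpos
  rw [deriv_tiltedMean hne hn hc]
  simp only
  rw [← hM, sub_pos, lt_div_iff₀ h0]
  linarith

/-- The second derivative equals the third central moment divided by the normalization. -/
theorem deriv_deriv_tiltedMean_neg (hne : Even n) (hn : 4 ≤ n) (hc : 0 < c) {t : ℝ}
    (ht : 0 < t) : deriv (deriv (tiltedMean n b c)) t < 0 := by
  have h0 := tiltedMoment_zero_pos (b := b) hne hn hc t
  have hneg := integral_sub_tiltedMean_cube_neg (b := b) hne hn hc ht
  have hI := fun k => integrable_pow_mul_tiltedWeight (b := b) hne hn hc k t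
  have hd := ((hasDerivAt_tiltedMoment (b := b) hne hn hc 2 t).div
    (hasDerivAt_tiltedMoment hne hn hc 0 t) h0.ne').sub
    ((hasDerivAt_tiltedMean (b := b) hne hn hc t).pow 2)
  rw [deriv_tiltedMean hne hn hc]
  refine hd.deriv.trans_lt ?_
  set M := tiltedMean n b c t with hM
  have e : (fun x => (x - M) ^ 3 * tiltedWeight n b c t x) = fun x =>
      (x ^ 3 * tiltedWeight n b c t x - 3 * M * (x ^ 2 * tiltedWeight n b c t x))
        + (3 * M ^ 2 * (x ^ 1 * tiltedWeight n b c t x)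
          - M ^ 3 * (x ^ 0 * tiltedWeight n b c t x)) := by
    funext x; ring
  rw [e, integral_add ((hI 3).sub' ((hI 2).const_mul _)) (((hI 1).const_mul _).sub'
    ((hI 0).const_mul _)), integral_sub (hI 3) ((hI 2).const_mul _),
    integral_sub ((hI 1).const_mul _) ((hI 0).const_mul _), integral_const_mul,
    integral_const_mul, integral_const_mul] at hneg
  change tiltedMoment n b c 3 t - 3 * M * tiltedMoment n b c 2 t
    + (3 * M ^ 2 * tiltedMoment n b c 1 t - M ^ 3 * tiltedMoment n b c 0 t) < 0 at hneg
  have e1 : tiltedMoment n b c 1 t = M * tiltedMoment n b c 0 t := (div_mul_cancel₀ _ h0.ne').symm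
  rw [e1] at hneg
  have := div_neg_of_neg_of_pos hneg h0
  refine lt_of_eq_of_lt ?_ this
  simp only [zero_add, Nat.reduceAdd, e1]
  field_simp
  ring

theorem tiltedMean_zero (hne : Even n) : tiltedMean n b c 0 = 0 := by
  have := tiltedMean_neg (n := n) (b := b) (c := c) hne 0
  rw [neg_zero] at this
  linarith

theorem strictAntiOn_deriv_tiltedMean (hne : Even n) (hn : 4 ≤ n) (hc : 0 < c) :
    StrictAntiOn (deriv (tiltedMean n b c)) (Set.Ici 0) := by
  refine strictAntiOn_of_deriv_neg (convex_Ici 0)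
    ((contDiff_tiltedMean hne hn hc).continuous_deriv (by simp)).continuousOn fun t ht => ?_
  rw [interior_Ici] at ht
  exact deriv_deriv_tiltedMean_neg hne hn hc ht

/-! ### Decay of the derivative of the mean -/

/-- If the derivative stayed at least `L`, the mean would be at least `L t`. As the mean is the
logarithmic derivative of `Z`, this forces `Z t ≥ Z 0 * exp (L t² / 2)`. -/
theorem exists_deriv_tiltedMean_lt (hne : Even n) (hn : 4 ≤ n) (hc : 0 < c) {L : ℝ}
    (hL : 0 < L) : ∃ t, 0 ≤ t ∧ deriv (tiltedMean n b c) t < L := by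
  by_contra! h
  have hdiff : ∀ t, HasDerivAt (tiltedMean n b c) (deriv (tiltedMean n b c) t) t := fun t =>
    (hasDerivAt_tiltedMean hne hn hc t).differentiableAt.hasDerivAt
  have hmean : ∀ t, 0 ≤ t → L * t ≤ tiltedMean n b c t := by
    intro t ht
    have := (convex_Ici (0 : ℝ)).mul_sub_le_image_sub_of_le_deriv (f := tiltedMean n b c) (C := L)
      (fun s _ => (hdiff s).continuousAt.continuousWithinAt)
      (fun s _ => (hdiff s).differentiableAt.differentiableWithinAt)
      (fun s hs => h s (by rw [interior_Ici] at hs; exact hs.le)) 0 Set.self_mem_Ici t ht ht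
    rwa [tiltedMean_zero hne, sub_zero, sub_zero] at this
  set Z := tiltedMoment n b c 0 with hZ
  have hder : ∀ t, HasDerivAt (fun t => Z t * Real.exp (-(L / 2 * t ^ 2)))
      ((tiltedMean n b c t - L * t) * (Z t * Real.exp (-(L / 2 * t ^ 2)))) t := by
    intro t
    have he : HasDerivAt (fun t : ℝ => -(L / 2 * t ^ 2)) (-(L * t)) t := by
      convert! ((hasDerivAt_pow 2 t).const_mul (L / 2)).neg using 1
      push_cast
      ring
    convert! (hasDerivAt_tiltedMoment (b := b) hne hn hc 0 t).mul he.exp using 1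
    have e1 : tiltedMoment n b c 1 t = tiltedMean n b c t * Z t :=
      (div_mul_cancel₀ _ (tiltedMoment_zero_pos hne hn hc t).ne').symm
    rw [zero_add, e1]
    ring
  have hmono : MonotoneOn (fun t => Z t * Real.exp (-(L / 2 * t ^ 2))) (Set.Ici 0) := by
    refine monotoneOn_of_deriv_nonneg (convex_Ici 0)
      (fun t _ => (hder t).continuousAt.continuousWithinAt)
      (fun t _ => (hder t).differentiableAt.differentiableWithinAt) fun t ht => ?_
    rw [interior_Ici] at ht
    rw [(hder t).deriv]
    exact mul_nonneg (sub_nonneg.2 (hmean t ht.le))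
      (mul_nonneg (tiltedMoment_zero_pos hne hn hc t).le (Real.exp_pos _).le)
  -- Any `κ` below `L / 2` would contradict this growth.
  obtain ⟨C, hC⟩ := exists_tiltedWeight_le (b := b) hne hn hc (κ := L / 4) (by positivity)
  have hG := integrable_exp_neg_mul_sq one_pos
  have hZle : ∀ t, Z t ≤ C * Real.exp (L / 4 * t ^ 2) * ∫ x, Real.exp (-1 * x ^ 2) := by
    intro t
    rw [← integral_const_mul]
    simp only [hZ, tiltedMoment, pow_zero, one_mul]
    exact integral_mono (integrable_tiltedWeight hne hn hc t) (hG.const_mul _) (hC t)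
  have hle : ∀ t, 0 ≤ t →
      Z 0 ≤ C * (∫ x, Real.exp (-1 * x ^ 2)) * Real.exp (-(L / 4 * t ^ 2)) := by
    intro t ht
    have h1 := hmono Set.self_mem_Ici ht ht
    have h2 := mul_le_mul_of_nonneg_right (hZle t) (Real.exp_pos (-(L / 2 * t ^ 2))).le
    have e : Real.exp (-(L / 4 * t ^ 2))
        = Real.exp (L / 4 * t ^ 2) * Real.exp (-(L / 2 * t ^ 2)) := by
      rw [← Real.exp_add]; ring_nf
    simp only [ne_eq, OfNat.ofNat_ne_zero, not_false_eq_true, zero_pow, mul_zero, neg_zero,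
      Real.exp_zero, mul_one] at h1
    rw [e]
    linarith
  have hlim : Tendsto (fun t : ℝ => C * (∫ x, Real.exp (-1 * x ^ 2)) *
      Real.exp (-(L / 4 * t ^ 2))) atTop (𝓝 0) := by
    have := (Real.tendsto_exp_neg_atTop_nhds_zero.comp
      ((tendsto_pow_atTop (α := ℝ) two_ne_zero).const_mul_atTop
        (by positivity : 0 < L / 4))).const_mul (C * ∫ x, Real.exp (-1 * x ^ 2))
    simpa using this
  exact (tiltedMoment_zero_pos (b := b) hne hn hc 0).not_ge
    (ge_of_tendsto hlim (eventually_atTop.2 ⟨0, hle⟩))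

theorem tendsto_deriv_tiltedMean (hne : Even n) (hn : 4 ≤ n) (hc : 0 < c) :
    Tendsto (deriv (tiltedMean n b c)) atTop (𝓝 0) := by
  rw [tendsto_order]
  refine ⟨fun l hl => .of_forall fun t => hl.trans (deriv_tiltedMean_pos hne hn hc t),
    fun L hL => ?_⟩
  obtain ⟨t, ht, hlt⟩ := exists_deriv_tiltedMean_lt (b := b) hne hn hc hL
  filter_upwards [eventually_ge_atTop t] with s hs
  exact ((strictAntiOn_deriv_tiltedMean hne hn hc).antitoneOn ht (ht.trans hs) hs).trans_lt hlt

end Potential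

/-! ### Dynamics of odd concave maps -/

/-- No contraction rate is assumed, which covers the critical case `deriv F 0 = 1`. The distances to
`p` decrease to some `l`; a cluster point `y` of the orbit satisfies `|y - p| = l = |F y - p|`, so
strict decrease forces `y = p`. -/
theorem IsStableFixedPt.of_abs_sub_lt {F : ℝ → ℝ} {p r : ℝ} (hF : Continuous F)
    (hp : Function.IsFixedPt F p) (hr : 0 < r)
    (h : ∀ x, x ≠ p → |x - p| < r → |F x - p| < |x - p|) : IsStableFixedPt F p := by
  have hle : ∀ x, |x - p| < r → |F x - p| ≤ |x - p| := by
    intro x hx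
    rcases eq_or_ne x p with rfl | hne
    · rw [hp.eq]
    · exact (h x hne hx).le
  have horb : ∀ x, |x - p| < r → ∀ k, |F^[k] x - p| ≤ |x - p| := by
    intro x hx k
    induction k with
    | zero => simp
    | succ k ih =>
      rw [Function.iterate_succ_apply']
      exact (hle _ (ih.trans_lt hx)).trans ih
  refine ⟨hp, fun ε hε => ⟨min ε r, lt_min hε hr, fun x hx k =>
    (horb x (hx.trans_le (min_le_right _ _)) k).trans_lt (hx.trans_le (min_le_left _ _))⟩,
    r, hr, fun x hx => ?_⟩
  have hanti : Antitone fun k => |F^[k] x - p| := by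
    refine antitone_nat_of_succ_le fun k => ?_
    rw [Function.iterate_succ_apply']
    exact hle _ ((horb x hx k).trans_lt hx)
  have hlim := tendsto_atTop_ciInf hanti ⟨0, by rintro _ ⟨k, rfl⟩; exact abs_nonneg _⟩
  set l := ⨅ k, |F^[k] x - p| with hl
  obtain ⟨y, hy, φ, hφ, hφy⟩ := (isCompact_closedBall p |x - p|).tendsto_subseq
    (x := fun k => F^[k] x) fun k => by
      rw [Metric.mem_closedBall, Real.dist_eq]
      exact horb x hx k
  have h1 : |y - p| = l :=
    tendsto_nhds_unique ((hφy.sub_const p).abs) (hlim.comp hφ.tendsto_atTop)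
  have h2 : |F y - p| = l := by
    refine tendsto_nhds_unique ((((hF.tendsto y).comp hφy).sub_const p).abs) ?_
    refine (hlim.comp ((tendsto_add_atTop_nat 1).comp hφ.tendsto_atTop)).congr fun k => ?_
    simp [Function.iterate_succ_apply']
  have hyp : y = p := by
    by_contra hne
    have := h y hne (((Metric.mem_closedBall.1 hy)).trans_lt hx)
    linarith
  rw [hyp, sub_self, abs_zero] at h1
  rw [← h1] at hlim
  rw [tendsto_iff_norm_sub_tendsto_zero]
  simpa using hlim

/-- An increasing odd map which is strictly concave on the positive half-line. -/
structure IsOddConcaveMap (F : ℝ → ℝ) : Prop where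
  differentiable : Differentiable ℝ F
  odd : ∀ m, F (-m) = -F m
  strictMono : StrictMono F
  strictConcaveOn : StrictConcaveOn ℝ (Set.Ici 0) F

namespace IsOddConcaveMap

variable {F : ℝ → ℝ}

theorem map_zero (h : IsOddConcaveMap F) : F 0 = 0 := by
  have := h.odd 0
  rw [neg_zero] at this
  linarith

theorem map_pos (h : IsOddConcaveMap F) {m : ℝ} (hm : 0 < m) : 0 < F m := by
  simpa [h.map_zero] using h.strictMono hm

theorem map_lt_deriv_mul (h : IsOddConcaveMap F) {m : ℝ} (hm : 0 < m) :
    F m < deriv F 0 * m := by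
  have := h.strictConcaveOn.slope_lt_deriv Set.self_mem_Ici (Set.mem_Ici.2 hm.le) hm
    (h.differentiable 0)
  rwa [slope_def_field, h.map_zero, sub_zero, sub_zero, div_lt_iff₀ hm] at this

theorem abs_map_lt (h : IsOddConcaveMap F) (hd : deriv F 0 ≤ 1) {m : ℝ} (hm : m ≠ 0) :
    |F m| < |m| := by
  have hpos : ∀ m, 0 < m → |F m| < |m| := fun m hm => by
    rw [abs_of_pos hm, abs_of_pos (h.map_pos hm)]
    have := h.map_lt_deriv_mul hm
    nlinarith
  rcases hm.lt_or_gt with hm | hm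
  · have := hpos (-m) (by linarith)
    rwa [h.odd, abs_neg, abs_neg] at this
  · exact hpos m hm

theorem setOf_isFixedPt_eq_singleton (h : IsOddConcaveMap F) (hd : deriv F 0 ≤ 1) :
    {m : ℝ | Function.IsFixedPt F m} = {0} := by
  ext m
  simp only [Set.mem_ofPred_eq, Set.mem_singleton_iff]
  constructor
  · intro hm
    by_contra hne
    have := h.abs_map_lt hd hne
    rw [hm.eq] at this
    exact this.false
  · rintro rfl
    exact h.map_zero

theorem isStableFixedPt_zero (h : IsOddConcaveMap F) (hd : deriv F 0 ≤ 1) :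
    IsStableFixedPt F 0 :=
  .of_abs_sub_lt h.differentiable.continuous h.map_zero one_pos fun x hx _ => by
    simpa using h.abs_map_lt hd hx

theorem lt_map_of_lt_fixed (h : IsOddConcaveMap F) {p m : ℝ} (hp : F p = p) (hm : 0 < m)
    (hmp : m < p) : m < F m := by
  have := h.strictConcaveOn.mul_lt_mul_of_map_zero h.map_zero hm hmp
  rw [hp, mul_comm] at this
  exact lt_of_mul_lt_mul_left this (hm.trans hmp).le

theorem map_lt_of_fixed_lt (h : IsOddConcaveMap F) {p m : ℝ} (hp : F p = p) (hp0 : 0 < p)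
    (hmp : p < m) : F m < m := by
  have := h.strictConcaveOn.mul_lt_mul_of_map_zero h.map_zero hp0 hmp
  rw [hp, mul_comm m] at this
  exact lt_of_mul_lt_mul_left this hp0.le

theorem exists_fixed_pos (h : IsOddConcaveMap F) (hd : 1 < deriv F 0)
    (hlim : Tendsto (deriv F) atTop (𝓝 0)) : ∃ p, 0 < p ∧ F p = p := by
  obtain ⟨x, hx, hxF⟩ : ∃ x, 0 < x ∧ x < F x := by
    have := (h.differentiable 0).hasDerivAt.tendsto_slope_zero_right
    obtain ⟨x, hx1, hx2⟩ := ((this.eventually_const_lt hd).and self_mem_nhdsWithin).exists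
    simp only [zero_add, h.map_zero, sub_zero, smul_eq_mul] at hx1
    have hx2 : 0 < x := hx2
    refine ⟨x, hx2, ?_⟩
    rw [inv_mul_eq_div, lt_div_iff₀ hx2, one_mul] at hx1
    exact hx1
  obtain ⟨y, hxy, hyF⟩ : ∃ y, x < y ∧ F y < y := by
    obtain ⟨T, hT⟩ := eventually_atTop.1 (hlim.eventually_lt_const (by norm_num : (0 : ℝ) < 1 / 2))
    set T' := max T x with hT'
    have hF : ∀ y, T' ≤ y → F y - F T' ≤ 1 / 2 * (y - T') := fun y hy =>
      (convex_Ici T').image_sub_le_mul_sub_of_deriv_le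
        h.differentiable.continuous.continuousOn h.differentiable.differentiableOn
        (fun s hs => (hT s (by
          rw [interior_Ici] at hs
          exact (le_max_left T x).trans hs.le)).le) T' Set.self_mem_Ici y hy hy
    -- Beyond `T'` the slope is at most `1/2`, so the increment `2|F T'| + 1` is enough for the
    -- diagonal to overtake `F`.
    refine ⟨T' + 2 * |F T'| + 1, ?_, ?_⟩
    · have := le_max_right T x
      have := abs_nonneg (F T')
      linarith
    · have := hF (T' + 2 * |F T'| + 1) (by linarith [abs_nonneg (F T')])
      have := le_abs_self (F T')
      have := le_max_right T x
      linarith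
  obtain ⟨p, hp, hpF⟩ := intermediate_value_Icc' hxy.le
    (h.differentiable.continuous.sub continuous_id).continuousOn
    (show (0 : ℝ) ∈ Set.Icc (F y - y) (F x - x) from ⟨by linarith, by linarith⟩)
  exact ⟨p, hx.trans_le hp.1, sub_eq_zero.1 hpF⟩

theorem setOf_isFixedPt_eq (h : IsOddConcaveMap F) {p : ℝ} (hp : F p = p) (hp0 : 0 < p) :
    {m : ℝ | Function.IsFixedPt F m} = {-p, 0, p} := by
  have huniq : ∀ m, 0 < m → F m = m → m = p := fun m hm hF => by
    rcases lt_trichotomy m p with hlt | heq | hgt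
    · exact absurd hF (h.lt_map_of_lt_fixed hp hm hlt).ne'
    · exact heq
    · exact absurd hF (h.map_lt_of_fixed_lt hp hp0 hgt).ne
  ext m
  simp only [Set.mem_ofPred_eq, Set.mem_insert_iff, Set.mem_singleton_iff]
  constructor
  · intro hm
    rcases lt_trichotomy m 0 with hlt | heq | hgt
    · left
      have := huniq (-m) (by linarith) (by rw [h.odd, hm.eq])
      linarith
    · exact .inr (.inl heq)
    · exact .inr (.inr (huniq m hgt hm))
  · rintro (rfl | rfl | rfl)
    · exact (h.odd p).trans (congrArg _ hp)
    · exact h.map_zero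
    · exact hp

/-- The radius `p` keeps `x` positive. There `F x` lies strictly between `x` and `p`: concavity
gives one side, monotonicity the other. -/
theorem abs_map_sub_lt (h : IsOddConcaveMap F) {p : ℝ} (hp : F p = p) (hp0 : 0 < p) {x : ℝ}
    (hx : x ≠ p) (hxp : |x - p| < p) : |F x - p| < |x - p| := by
  have hx0 : 0 < x := by linarith [(abs_lt.1 hxp).1]
  rcases hx.lt_or_gt with hlt | hgt
  · have h1 := h.lt_map_of_lt_fixed hp hx0 hlt
    have h2 := h.strictMono hlt
    rw [hp] at h2
    rw [abs_of_neg (by linarith), abs_of_neg (by linarith)]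
    linarith
  · have h1 := h.map_lt_of_fixed_lt hp hp0 hgt
    have h2 := h.strictMono hgt
    rw [hp] at h2
    rw [abs_of_pos (by linarith), abs_of_pos (by linarith)]
    linarith

theorem isStableFixedPt_of_pos (h : IsOddConcaveMap F) {p : ℝ} (hp : F p = p) (hp0 : 0 < p) :
    IsStableFixedPt F p :=
  .of_abs_sub_lt h.differentiable.continuous hp hp0 fun _ => h.abs_map_sub_lt hp hp0

theorem isStableFixedPt_neg (h : IsOddConcaveMap F) {p : ℝ} (hp : F p = p) (hp0 : 0 < p) :
    IsStableFixedPt F (-p) := by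
  refine .of_abs_sub_lt h.differentiable.continuous ((h.odd p).trans (congrArg _ hp)) hp0
    fun x hx hxp => ?_
  have e : ∀ y, |y - -p| = |-y - p| := fun y => by rw [← abs_neg]; ring_nf
  rw [e] at hxp
  rw [e, e, ← h.odd]
  exact h.abs_map_sub_lt hp hp0 (fun hxe => hx (by linarith)) hxp

/-- An orbit starting in `(0, p)` increases. If it stayed below `p / 2`, its limit would be a fixed
point strictly between `0` and `p`. -/
theorem isUnstableFixedPt_zero (h : IsOddConcaveMap F) {p : ℝ} (hp : F p = p) (hp0 : 0 < p) :
    IsUnstableFixedPt F 0 := by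
  refine ⟨h.map_zero, fun hL => ?_⟩
  obtain ⟨δ, hδ, hstab⟩ := hL (p / 2) (by linarith)
  set x := min (δ / 2) (p / 2) with hx
  have hx0 : 0 < x := lt_min (by linarith) (by linarith)
  have hxδ : x < δ := (min_le_left _ _).trans_lt (by linarith)
  have hxp : x < p := (min_le_right _ _).trans_lt (by linarith)
  have hbd : ∀ k, F^[k] x < p / 2 := fun k => by
    have := hstab x (by rwa [sub_zero, abs_of_pos hx0]) k
    rw [sub_zero] at this
    exact (le_abs_self _).trans_lt this
  have hmono : Monotone fun k => F^[k] x :=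
    h.strictMono.monotone.monotone_iterate_of_le_map (h.lt_map_of_lt_fixed hp hx0 hxp).le
  have hlim := tendsto_atTop_ciSup hmono ⟨p / 2, by rintro _ ⟨k, rfl⟩; exact (hbd k).le⟩
  set l := ⨆ k, F^[k] x with hl
  have hfix := isFixedPt_of_tendsto_iterate hlim h.differentiable.continuous.continuousAt
  have h1 : x ≤ l := hmono.ge_of_tendsto hlim 0
  have h2 : l ≤ p / 2 := le_of_tendsto' hlim fun k => (hbd k).le
  exact (h.lt_map_of_lt_fixed hp (hx0.trans_le h1) (by linarith)).ne' hfix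

end IsOddConcaveMap

/-! ### Parity and transfer to the self-consistency map -/

theorem iteratedDeriv_two_mul_zero_of_odd {F : ℝ → ℝ} (hodd : ∀ m, F (-m) = -F m) (k : ℕ) :
    iteratedDeriv (2 * k) F 0 = 0 := by
  have h := iteratedDeriv_comp_neg (2 * k) F (0 : ℝ)
  rw [funext hodd, iteratedDeriv_fun_neg] at h
  simp only [neg_zero, even_two, Even.mul_right, Even.neg_pow, one_pow, one_smul] at h
  linarith

theorem iteratedDeriv_two_neg_of_odd {F : ℝ → ℝ} (hodd : ∀ m, F (-m) = -F m) (m : ℝ) :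
    iteratedDeriv 2 F (-m) = -iteratedDeriv 2 F m := by
  have h := iteratedDeriv_comp_neg 2 F m
  rw [funext hodd, iteratedDeriv_fun_neg] at h
  simp only [even_two, Even.neg_pow, one_pow, one_smul] at h
  exact h.symm

section StationaryDensity

variable {n : ℕ} {a D σ : ℝ}

theorem stationaryWeight_eq (m x : ℝ) :
    stationaryWeight (doubleWell n a) D σ m x =
      tiltedWeight n ((D - a) / σ ^ 2) (2 / (σ ^ 2 * n)) (2 * D / σ ^ 2 * m) x := by
  unfold stationaryWeight doubleWell tiltedWeight evenPotential
  congr 1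
  simp only [div_eq_mul_inv, mul_inv]
  ring

theorem stationaryZ_eq (m : ℝ) :
    stationaryZ (doubleWell n a) D σ m =
      tiltedMoment n ((D - a) / σ ^ 2) (2 / (σ ^ 2 * n)) 0 (2 * D / σ ^ 2 * m) := by
  simp only [stationaryZ, tiltedMoment, stationaryWeight_eq, pow_zero, one_mul]

theorem selfConsistencyMap_eq :
    selfConsistencyMap (doubleWell n a) D σ = fun m =>
      tiltedMean n ((D - a) / σ ^ 2) (2 / (σ ^ 2 * n)) (2 * D / σ ^ 2 * m) := by
  funext m
  simp only [selfConsistencyMap, stationaryDensity, stationaryZ_eq, stationaryWeight_eq]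
  rw [tiltedMean, div_eq_inv_mul (tiltedMoment _ _ _ 1 _), tiltedMoment.eq_1 n _ _ 1,
    ← integral_const_mul]
  congr 1
  funext x
  ring

/-- An even density has mean zero, whereas at a nonzero fixed point the mean is that point; this
gives the symmetry breaking. -/
theorem selfConsistencyMap_eq_zero_of_even (m : ℝ)
    (h : Function.Even (stationaryDensity (doubleWell n a) D σ m)) :
    selfConsistencyMap (doubleWell n a) D σ m = 0 := by
  have := integral_neg_eq_self (fun x => x * stationaryDensity (doubleWell n a) D σ m x) volume
  simp only [h.eq, neg_mul, integral_neg] at this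
  unfold selfConsistencyMap
  linarith

end StationaryDensity

theorem mainTheorem3 (n : ℕ) (hn_even : Even n) (hn : 4 ≤ n) (a D σ : ℝ) (hD : 0 < D)
    (hσ : 0 < σ) (F : ℝ → ℝ) (hF : F = selfConsistencyMap (doubleWell n a) D σ) :
    -- the density and its mean are well defined
    (∀ m : ℝ, Integrable (stationaryWeight (doubleWell n a) D σ m) ∧
      0 < stationaryZ (doubleWell n a) D σ m ∧
      Integrable (fun x : ℝ => x * stationaryDensity (doubleWell n a) D σ m x)) ∧
    -- properties of the self-consistency map
    ContDiff ℝ ∞ F ∧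
    (∀ k : ℕ, iteratedDeriv (2 * k) F 0 = 0) ∧
    (∀ m : ℝ, F m = -F (-m)) ∧
    ((∀ m : ℝ, 0 < m → iteratedDeriv 2 F m < 0) ∧
      iteratedDeriv 2 F 0 = 0 ∧
      (∀ m : ℝ, m < 0 → 0 < iteratedDeriv 2 F m)) ∧
    Tendsto (deriv F) atTop (𝓝 0) ∧
    -- symmetric phase
    (deriv F 0 ≤ 1 →
      {m : ℝ | Function.IsFixedPt F m} = {0} ∧ IsStableFixedPt F 0) ∧
    -- symmetry-broken phase
    (1 < deriv F 0 →
      IsUnstableFixedPt F 0 ∧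
      ∃ mp : ℝ, 0 < mp ∧
        {m : ℝ | Function.IsFixedPt F m} = {-mp, 0, mp} ∧
        IsStableFixedPt F mp ∧ IsStableFixedPt F (-mp) ∧
        ¬ Function.Even (stationaryDensity (doubleWell n a) D σ mp) ∧
        ¬ Function.Even (stationaryDensity (doubleWell n a) D σ (-mp))) := by
  have hn0 : (0 : ℝ) < n := by exact_mod_cast (by omega : 0 < n)
  set b := (D - a) / σ ^ 2 with hb
  set c := 2 / (σ ^ 2 * n) with hc'
  set β := 2 * D / σ ^ 2 with hβ'
  have hc : 0 < c := by positivity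
  have hβ : 0 < β := by positivity
  have hF' : F = fun m => tiltedMean n b c (β * m) := hF.trans selfConsistencyMap_eq
  have hcd : ContDiff ℝ ∞ F := by
    rw [hF']
    exact (contDiff_tiltedMean hn_even hn hc).comp (by fun_prop)
  have hodd : ∀ m, F (-m) = -F m := fun m => by
    simp only [hF', mul_neg, tiltedMean_neg hn_even]
  have hd1 : deriv F = fun m => β * deriv (tiltedMean n b c) (β * m) := by
    rw [hF']
    funext m
    exact deriv_comp_mul_left β (tiltedMean n b c) m
  have hd2 : iteratedDeriv 2 F = fun m => β * (β * deriv (deriv (tiltedMean n b c)) (β * m)) := by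
    rw [iteratedDeriv_succ, iteratedDeriv_one, hd1]
    funext m
    rw [deriv_const_mul_field]
    congr 1
    exact deriv_comp_mul_left β (deriv (tiltedMean n b c)) m
  have hneg : ∀ m, 0 < m → iteratedDeriv 2 F m < 0 := fun m hm => by
    rw [hd2]
    exact mul_neg_of_pos_of_neg hβ (mul_neg_of_pos_of_neg hβ
      (deriv_deriv_tiltedMean_neg hn_even hn hc (mul_pos hβ hm)))
  have hlim : Tendsto (deriv F) atTop (𝓝 0) := by
    rw [hd1]
    simpa using ((tendsto_deriv_tiltedMean hn_even hn hc).comp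
      (tendsto_id.const_mul_atTop hβ)).const_mul β
  have hmap : IsOddConcaveMap F :=
    { differentiable := hcd.differentiable (by simp)
      odd := hodd
      strictMono := strictMono_of_deriv_pos fun m => by
        rw [hd1]
        exact mul_pos hβ (deriv_tiltedMean_pos hn_even hn hc _)
      strictConcaveOn := strictConcaveOn_of_deriv2_neg (convex_Ici 0) hcd.continuous.continuousOn
        fun m hm => by
          rw [interior_Ici] at hm
          rw [← iteratedDeriv_eq_iterate]
          exact hneg m hm }
  refine ⟨fun m => ⟨?_, ?_, ?_⟩, hcd, iteratedDeriv_two_mul_zero_of_odd hodd,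
    fun m => by rw [hodd, neg_neg], ⟨hneg, iteratedDeriv_two_mul_zero_of_odd hodd 1,
      fun m hm => ?_⟩, hlim,
    fun hd => ⟨hmap.setOf_isFixedPt_eq_singleton hd, hmap.isStableFixedPt_zero hd⟩, fun hd => ?_⟩
  · exact (integrable_tiltedWeight hn_even hn hc (β * m)).congr
      (.of_forall fun x => (stationaryWeight_eq m x).symm)
  · rw [stationaryZ_eq]
    exact tiltedMoment_zero_pos hn_even hn hc _
  · refine ((integrable_pow_mul_tiltedWeight (b := b) hn_even hn hc 1 (β * m)).const_mul
      (1 / stationaryZ (doubleWell n a) D σ m)).congr (.of_forall fun x => ?_)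
    simp only [stationaryDensity, stationaryWeight_eq, pow_one]
    ring
  · have := hneg (-m) (by linarith)
    rw [iteratedDeriv_two_neg_of_odd hodd] at this
    linarith
  · obtain ⟨p, hp0, hp⟩ := hmap.exists_fixed_pos hd hlim
    refine ⟨hmap.isUnstableFixedPt_zero hp hp0, p, hp0, hmap.setOf_isFixedPt_eq hp hp0,
      hmap.isStableFixedPt_of_pos hp hp0, hmap.isStableFixedPt_neg hp hp0, fun he => ?_,
      fun he => ?_⟩
    · have := selfConsistencyMap_eq_zero_of_even p he
      rw [← hF, hp] at this
      exact hp0.ne' this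
    · have := selfConsistencyMap_eq_zero_of_even (-p) he
      rw [← hF, hodd, hp] at this
      linarith
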